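/- Let $G=(V,E)$ be a finite simple graph with graph state $|G\rangle=\prod_{(i,j)\in E}CZ_{ij}|+\rangle^{\otimes V}$. For an ordering $p=p_1\dots p_n$ of the vertices ($n=|V|$) and $0\le k\le n$, let the height function $h(G,p,k)$ be the bipartite entanglement entropy (von Neumann entropy, in bits, of the reduced state) of $|G\rangle$ between $\{p_1,\dots,p_k\}$ and the remaining vertices, and define the minimum number of static qubits by $$n_s^{\min}(G)=\min_p\max_k h(G,p,k).$$ Fix a set $\mathcal U$ of available single-qubit gates that contains all single-qubit Clifford gates and consists of unitaries (for instance, exactly the Clifford gates, or all unitaries). A single quantum emitter has one spin qubit, initially in the state $|+\rangle$; it may undergo any sequence of gates from $\mathcal U$ on the spin or on emitted photons, photon emissions $|b\rangle_s\mapsto|b\rangle_s|b\rangle_{\text{new}}$ ($b\in\{0,1\}$, extended linearly), and measurements of the spin in the computational basis. A construction of $|G\rangle$ from one emitter first generates a state in this way, measures out the spin, and then applies to the photons, in any order, gates from $\mathcal U$, destructive single-qubit measurements in the computational basis, and successful fusions (destructive Bell-state measurements of two photons, i.e. projection of the two photons onto one of the four Bell states, after which they are discarded), so that for some sequence of measurement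 outcomes of nonzero probability the remaining photons are labelled by $V$ and their state is $|G\rangle$ up to a scalar. Let $n_f^{\min}(G)$ be the minimum number of successful fusions in such a construction. Then a construction exists, so that $n_f^{\min}(G)$ is well defined; $n_s^{\min}(G)$ equals the linear rank-width of $G$, i.e. the minimum over vertex orderings $p$ of the maximum over $k$ of the rank over $\mathbb F_2$ of the submatrix of the adjacency matrix with rows $p_1,\dots,p_k$ and columns $p_{k+1},\dots,p_n$; and $$n_f^{\min}(G)+1\ \ge\ n_s^{\min}(G).$$ -/

import Mathlib

noncomputable section

universe u

/-! ### Pure states of a register of qubits -/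

/-- A (not necessarily normalised) state vector of the register of qubits `Q`, given by its
amplitudes in the computational basis `|x⟩`, `x : Q → Fin 2`. -/
abbrev QState (Q : Type*) : Type _ := (Q → Fin 2) → ℂ

/-- The qubits of a register are renamed along a bijection. -/
def QState.relabel {P Q : Type*} (e : P ≃ Q) (ψ : QState P) : QState Q :=
  fun x => ψ (fun p => x (e p))

/-- The single-qubit operator `U` acts on qubit `q`. -/
def QState.gate {Q : Type*} [DecidableEq Q] (U : Matrix (Fin 2) (Fin 2) ℂ) (q : Q)
    (ψ : QState Q) : QState Q :=
  fun x => ∑ b : Fin 2, U (x q) b * ψ (Function.update x q b)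

/-- Destructive measurement of the qubit `none` in the computational basis with outcome `b`:
the (unnormalised) state `⟨b|ψ⟩` of the remaining qubits. -/
def QState.measure {P : Type*} (b : Fin 2) (ψ : QState (Option P)) : QState P :=
  fun x => ψ (fun q => q.elim b x)

/-- Successful fusion (destructive Bell state measurement) of the two qubits `none` and
`some none`: the state is projected onto the Bell state `|0, t⟩ + (-1)^s |1, 1 + t⟩` of these two
qubits, which are then discarded. The four pairs `(s, t)` are the four Bell states. Fusions that
measure other pairs of commuting two-qubit Pauli parities are obtained by applying single-qubit
Clifford gates before it. -/
def QState.fuse {P : Type*} (s t : Fin 2) (ψ : QState (Option (Option P))) : QState P :=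
  fun x => ∑ b : Fin 2, (-1 : ℂ) ^ (s * b : Fin 2).val *
    ψ (fun q => q.elim b (fun q' => q'.elim (b + t) x))

/-! ### Single-qubit Clifford gates -/

/-- The Pauli matrices `X`, `Y`, `Z`. -/
def pauliMatrices : Set (Matrix (Fin 2) (Fin 2) ℂ) :=
  {!![0, 1; 1, 0], !![0, -Complex.I; Complex.I, 0], !![1, 0; 0, -1]}

/-- The single-qubit Clifford gates: the unitaries that map every Pauli matrix to a Pauli matrix
up to sign under conjugation. -/
def cliffordGates : Set (Matrix (Fin 2) (Fin 2) ℂ) :=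
  {U | U ∈ Matrix.unitaryGroup (Fin 2) ℂ ∧
    ∀ A ∈ pauliMatrices, U * A * star U ∈ pauliMatrices ∨ -(U * A * star U) ∈ pauliMatrices}

/-! ### A single quantum emitter -/

/-- Emission of a photon. In `Option P` the qubit `none` is the spin of the emitter and the
qubits `some p` are the photons emitted so far; the new photon is `some none`. It is emitted by
the isometry `|0⟩ₛ ↦ |0⟩ₛ|0⟩ₙ`, `|1⟩ₛ ↦ |1⟩ₛ|1⟩ₙ`, that is, by a CNOT gate with control the spin
and target the new photon in state `|0⟩ₙ`. -/
def QState.emit {P : Type*} (ψ : QState (Option P)) : QState (Option (Option P)) :=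
  fun x => if x (some none) = x none then
    ψ (fun q => q.elim (x none) (fun p => x (some (some p)))) else 0

/-- `EmitterGenerates 𝒰 P ψ`: a single quantum emitter, whose one static qubit is its spin, can
generate the joint state `ψ` of its spin `none` and the photons `some p`, `p : P`, when the
single-qubit gates from `𝒰` are available. The spin starts in the state `|+⟩`. -/
inductive EmitterGenerates (𝒰 : Set (Matrix (Fin 2) (Fin 2) ℂ)) :
    (P : Type u) → QState (Option P) → Prop
  /-- the initial state `|+⟩` of the spin, no photon -/
  | init : EmitterGenerates 𝒰 PEmpty (fun _ => ((Real.sqrt 2 : ℝ) : ℂ)⁻¹)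
  /-- a single-qubit gate on the spin or on a photon -/
  | gate {P : Type u} [DecidableEq P] {ψ : QState (Option P)} (U : Matrix (Fin 2) (Fin 2) ℂ)
      (hU : U ∈ 𝒰) (q : Option P) (h : EmitterGenerates 𝒰 P ψ) :
      EmitterGenerates 𝒰 P (ψ.gate U q)
  /-- emission of a photon -/
  | emit {P : Type u} {ψ : QState (Option P)} (h : EmitterGenerates 𝒰 P ψ) :
      EmitterGenerates 𝒰 (Option P) ψ.emit
  /-- measurement of the spin with outcome `b`; the spin is then in the state `|b⟩` -/
  | measureSpin {P : Type u} {ψ : QState (Option P)} (b : Fin 2) (h : EmitterGenerates 𝒰 P ψ) :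
      EmitterGenerates 𝒰 P (fun x => if x none = b then ψ x else 0)

/-! ### Constructions with fusions -/

/-- `FusionBuilds 𝒰 P n ψ`: the state `ψ` of the photons `P` is obtained from a state generated by
a single quantum emitter by means of single-qubit gates from `𝒰`, single-qubit measurements and
exactly `n` successful fusions. Vectors are not normalised; an outcome of probability zero gives
the vector `0`, which remains `0` in all later steps. -/
inductive FusionBuilds (𝒰 : Set (Matrix (Fin 2) (Fin 2) ℂ)) :
    (P : Type u) → ℕ → QState P → Prop
  /-- the emitter generates the initial state, and its spin is measured out -/
  | source {P : Type u} {ψ : QState (Option P)} (b : Fin 2) (h : EmitterGenerates 𝒰 P ψ) :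
      FusionBuilds 𝒰 P 0 (ψ.measure b)
  /-- the photons are renamed -/
  | relabel {P Q : Type u} {n : ℕ} {ψ : QState P} (e : P ≃ Q) (h : FusionBuilds 𝒰 P n ψ) :
      FusionBuilds 𝒰 Q n (ψ.relabel e)
  /-- a single-qubit gate on a photon -/
  | gate {P : Type u} [DecidableEq P] {n : ℕ} {ψ : QState P} (U : Matrix (Fin 2) (Fin 2) ℂ)
      (hU : U ∈ 𝒰) (p : P) (h : FusionBuilds 𝒰 P n ψ) :
      FusionBuilds 𝒰 P n (ψ.gate U p)
  /-- a destructive single-qubit measurement of a photon -/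
  | measure {P : Type u} {n : ℕ} {ψ : QState (Option P)} (b : Fin 2)
      (h : FusionBuilds 𝒰 (Option P) n ψ) : FusionBuilds 𝒰 P n (ψ.measure b)
  /-- a successful fusion of two photons -/
  | fuse {P : Type u} {n : ℕ} {ψ : QState (Option (Option P))} (s t : Fin 2)
      (h : FusionBuilds 𝒰 (Option (Option P)) n ψ) : FusionBuilds 𝒰 P (n + 1) (ψ.fuse s t)

section Graph

variable {V : Type u} [Fintype V] [DecidableEq V]

/-- The graph state `|G⟩ = ∏_{(i, j) ∈ E} CZ_{ij} |+⟩^{⊗ V}`: the gate `CZ_{ij}` multiplies the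
amplitude of `|x⟩` by `(-1) ^ (x i * x j)`. -/
def graphState (G : SimpleGraph V) [DecidableRel G.Adj] : QState V :=
  fun x => (∏ e ∈ G.edgeFinset, Sym2.lift (α := V) (β := ℂ)
      ⟨fun i j => (-1) ^ (x i * x j).val, fun i j => by beta_reduce; rw [mul_comm (x i)]⟩ e) *
    ((Real.sqrt 2 : ℝ) : ℂ)⁻¹ ^ Fintype.card V

/-- The graph state of `G` can be constructed, up to a scalar factor, from one quantum emitter
with exactly `n` successful fusions. -/
def FusionConstructible (𝒰 : Set (Matrix (Fin 2) (Fin 2) ℂ)) (G : SimpleGraph V)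
    [DecidableRel G.Adj] (n : ℕ) : Prop :=
  ∃ c : ℂ, c ≠ 0 ∧ FusionBuilds 𝒰 V n (c • graphState G)

/-- The minimum number `n_f^min(G)` of successful fusions in a construction of the graph state
of `G` from one quantum emitter. -/
def minFusions (𝒰 : Set (Matrix (Fin 2) (Fin 2) ℂ)) (G : SimpleGraph V) [DecidableRel G.Adj] : ℕ :=
  sInf {n | FusionConstructible 𝒰 G n}

/-! ### Entanglement entropy, height function, linear rank-width -/

/-- The coefficients of the state `ψ` with respect to the bipartition of the qubits into `A` and
its complement. -/
def bipartiteMatrix (ψ : QState V) (A : Finset V) :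
    Matrix ({v // v ∈ A} → Fin 2) ({v // v ∉ A} → Fin 2) ℂ :=
  fun a b => ψ (fun v => if h : v ∈ A then a ⟨v, h⟩ else b ⟨v, h⟩)

/-- The reduced density matrix on `A`: the partial trace of `|ψ⟩⟨ψ|` over the complement of `A`. -/
def reducedDensity (ψ : QState V) (A : Finset V) :
    Matrix ({v // v ∈ A} → Fin 2) ({v // v ∈ A} → Fin 2) ℂ :=
  bipartiteMatrix ψ A * (bipartiteMatrix ψ A).conjTranspose

theorem reducedDensity_isHermitian (ψ : QState V) (A : Finset V) :
    (reducedDensity ψ A).IsHermitian :=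
  Matrix.isHermitian_mul_conjTranspose_self _

/-- The entanglement entropy of a normalised state `ψ` between `A` and its complement, in bits:
the von Neumann entropy `-∑ λ log₂ λ` of the reduced density matrix on `A`, the sum being over its
eigenvalues with multiplicity. -/
def entanglementEntropy (ψ : QState V) (A : Finset V) : ℝ :=
  -∑ i, (reducedDensity_isHermitian ψ A).eigenvalues i *
    Real.logb 2 ((reducedDensity_isHermitian ψ A).eigenvalues i)

/-- The first `k` vertices in the order `p`. -/
def prefixSet (p : Fin (Fintype.card V) ≃ V) (k : ℕ) : Finset V :=
  Finset.univ.filter (fun v => (p.symm v : ℕ) < k)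

/-- The height function `h(G, p, k)`: the entanglement entropy of the graph state between the
first `k` vertices in the order `p` and the others. -/
def heightFunction (G : SimpleGraph V) [DecidableRel G.Adj] (p : Fin (Fintype.card V) ≃ V)
    (k : ℕ) : ℝ :=
  entanglementEntropy (graphState G) (prefixSet p k)

/-- `n_s^min(G) = min_p max_k h(G, p, k)`. -/
def minStaticQubits (G : SimpleGraph V) [DecidableRel G.Adj] : ℝ :=
  ⨅ p : Fin (Fintype.card V) ≃ V, ⨆ k : Fin (Fintype.card V + 1), heightFunction G p k

/-- The cut-rank of `A`: the rank over `𝔽₂` of the part of the adjacency matrix with rows in `A`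
and columns outside `A`. -/
def cutRank (G : SimpleGraph V) [DecidableRel G.Adj] (A : Finset V) : ℕ :=
  ((G.adjMatrix (ZMod 2)).submatrix (fun i : {v // v ∈ A} => (i : V))
    (fun j : {v // v ∉ A} => (j : V))).rank

/-- The linear rank-width: the minimum, over all linear orders of the vertices, of the maximal
cut-rank of an initial segment. -/
def linearRankWidth (G : SimpleGraph V) [DecidableRel G.Adj] : ℕ :=
  ⨅ p : Fin (Fintype.card V) ≃ V, ⨆ k : Fin (Fintype.card V + 1), cutRank G (prefixSet p k)

end Graph

end

universe u

/-! Lower bound: order the photons by emission time. When the last photon of an initial segment has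
just been emitted, only the spin qubit lies outside the segment, so the Schmidt rank is at most 2;
afterwards every operation acts on one side of the cut (`EmitterGenerates.hasSchmidtRankLE`). A Bell
projection is a sum of two product projections, so each fusion at most doubles the rank at every
cut, which gives `2 ^ (n + 1)` after `n` fusions (`FusionBuilds.hasSchmidtRankLE`). The reduced
density matrix of a graph state is `2 ^ (-cutRank)` times a projection
(`reducedDensity_graphState_mul_self`). Hence its entropy is the cut-rank, which identifies the two
widths, and its Schmidt rank is `2 ^ cutRank`; comparison with the bound above gives `cutRank ≤ n +
1` along the inherited order. Existence: an emitter produces any product of GHZ states, hence copies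
of each vertex qubit in `|+⟩`. A Hadamard gate and a fusion on a copy of `u` and a copy of `v` apply
`CZ` to `u` and `v`, so one fusion per edge suffices. -/

/-- `ψ` is a sum of `r` products of a function of the qubits in `A` and a function of the other
qubits. -/
def HasSchmidtRankLE {Q : Type*} (ψ : QState Q) (A : Set Q) (r : ℕ) : Prop :=
  ∃ α β : Fin r → QState Q, (∀ i, DependsOn (α i) A) ∧ (∀ i, DependsOn (β i) Aᶜ) ∧
    ∀ x, ψ x = ∑ i, α i x * β i x

/-! ### Schmidt rank under local operations. -/

namespace HasSchmidtRankLE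

variable {P Q : Type*} {ψ : QState Q} {A : Set Q} {r : ℕ}

theorem of_fintype {ι : Type*} [Fintype ι] (hr : Fintype.card ι = r) (α β : ι → QState Q)
    (hα : ∀ i, DependsOn (α i) A) (hβ : ∀ i, DependsOn (β i) Aᶜ)
    (h : ∀ x, ψ x = ∑ i, α i x * β i x) : HasSchmidtRankLE ψ A r := by
  let e := (Fintype.equivFinOfCardEq hr).symm
  refine ⟨fun i => α (e i), fun i => β (e i), fun i => hα _, fun i => hβ _, fun x => ?_⟩
  rw [h, ← e.sum_comp]

theorem compl (h : HasSchmidtRankLE ψ A r) : HasSchmidtRankLE ψ Aᶜ r := by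
  obtain ⟨α, β, hα, hβ, h⟩ := h
  refine ⟨β, α, hβ, by simpa using hα, fun x => ?_⟩
  simp_rw [h, mul_comm]

theorem add {φ : QState Q} {s : ℕ} (hψ : HasSchmidtRankLE ψ A r) (hφ : HasSchmidtRankLE φ A s) :
    HasSchmidtRankLE (fun x => ψ x + φ x) A (r + s) := by
  obtain ⟨α, β, hα, hβ, h⟩ := hψ
  obtain ⟨α', β', hα', hβ', h'⟩ := hφ
  refine of_fintype (ι := Fin r ⊕ Fin s) (by simp) (Sum.elim α α') (Sum.elim β β') ?_ ?_ ?_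
  · rintro (i | i) <;> simp [hα, hα']
  · rintro (i | i) <;> simp [hβ, hβ']
  · intro x
    simp [h, h']

theorem mul_right {γ : QState Q} (h : HasSchmidtRankLE ψ A r) (hγ : DependsOn γ Aᶜ) :
    HasSchmidtRankLE (fun x => ψ x * γ x) A r := by
  obtain ⟨α, β, hα, hβ, h⟩ := h
  refine ⟨α, fun i x => β i x * γ x, hα, fun i x y hxy => ?_, fun x => ?_⟩
  · simp only [hβ i hxy, hγ hxy]
  · simp only [h, Finset.sum_mul, mul_assoc]

theorem mul_const (h : HasSchmidtRankLE ψ A r) (c : ℂ) :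
    HasSchmidtRankLE (fun x => ψ x * c) A r :=
  h.mul_right fun _ _ _ => rfl

/-- Each factor still reads only its own side after the substitution. This covers renaming, fixing
measured qubits to constants and re-reading the spin at an emission. -/
theorem comp {B : Set P} (h : HasSchmidtRankLE ψ A r) (T : (P → Fin 2) → Q → Fin 2)
    (hA : ∀ q ∈ A, DependsOn (fun x => T x q) B) (hA' : ∀ q ∉ A, DependsOn (fun x => T x q) Bᶜ) :
    HasSchmidtRankLE (fun x => ψ (T x)) B r := by
  obtain ⟨α, β, hα, hβ, h⟩ := h
  exact ⟨fun i x => α i (T x), fun i x => β i (T x),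
    fun i x y hxy => hα i fun q hq => hA q hq hxy,
    fun i x y hxy => hβ i fun q hq => hA' q hq hxy, fun x => h _⟩

theorem gate_of_mem [DecidableEq Q] (h : HasSchmidtRankLE ψ A r)
    (U : Matrix (Fin 2) (Fin 2) ℂ) {q : Q} (hq : q ∈ A) : HasSchmidtRankLE (ψ.gate U q) A r := by
  obtain ⟨α, β, hα, hβ, h⟩ := h
  refine ⟨fun i => (α i).gate U q, β, fun i x y hxy => ?_, hβ, fun x => ?_⟩
  · have hu : ∀ b, α i (Function.update x q b) = α i (Function.update y q b) := fun b =>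
      hα i fun j hj => by
        by_cases hjq : j = q
        · subst hjq; simp
        · simp [hjq, hxy j hj]
    simp only [QState.gate, hxy q hq, hu]
  · have hu : ∀ i b, β i (Function.update x q b) = β i x := fun i b => hβ i fun j hj => by
      have : j ≠ q := fun hjq => hj (hjq ▸ hq)
      simp [this]
    simp only [QState.gate, h, hu, Finset.mul_sum, Finset.sum_mul, mul_assoc]
    exact Finset.sum_comm

theorem gate [DecidableEq Q] (h : HasSchmidtRankLE ψ A r)
    (U : Matrix (Fin 2) (Fin 2) ℂ) (q : Q) : HasSchmidtRankLE (ψ.gate U q) A r := by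
  by_cases hq : q ∈ A
  · exact h.gate_of_mem U hq
  · simpa using (h.compl.gate_of_mem U (q := q) hq).compl

/-- Expansion over the two values of the bit at `q`. -/
theorem compl_singleton (ψ : QState Q) (q : Q) : HasSchmidtRankLE ψ {q}ᶜ 2 := by
  classical
  refine ⟨fun b x => ψ (Function.update x q b), fun b x => if x q = b then 1 else 0, ?_, ?_, ?_⟩
  · intro b x y hxy
    have : Function.update x q b = Function.update y q b := by
      ext j
      by_cases hjq : j = q
      · subst hjq; simp
      · simp [hjq, hxy j hjq]
    simp only [this]
  · intro b x y hxy
    simp only [hxy q (by simp)]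
  · intro x
    simp

end HasSchmidtRankLE

/-! ### Schmidt rank bounds for emitters and fusions. -/

/-- Across every cut in the (reversed) order of emission, the joint state of the photons and the
spin of a single emitter has Schmidt rank at most two. -/
theorem EmitterGenerates.hasSchmidtRankLE {𝒰 : Set (Matrix (Fin 2) (Fin 2) ℂ)} {P : Type u}
    {ψ : QState (Option P)} (h : EmitterGenerates 𝒰 P ψ) :
    ∃ f : P → ℕ, f.Injective ∧ ∀ k, HasSchmidtRankLE ψ (some '' {p | k ≤ f p}) 2 := by
  induction h with
  | init =>
    refine ⟨fun _ => 0, fun x => x.elim, fun k => ?_⟩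
    convert HasSchmidtRankLE.compl_singleton _ (none : Option PEmpty)
    ext (_ | x)
    · simp
    · exact x.elim
  | gate U hU q h ih =>
    obtain ⟨f, hf, ih⟩ := ih
    exact ⟨f, hf, fun k => (ih k).gate U q⟩
  | @emit P ψ h ih =>
    obtain ⟨f, hf, ih⟩ := ih
    -- The newest photon gets 0 and the others shift up, so every superlevel set consists of the
    -- oldest photons; the spin is always on the other side.
    refine ⟨fun q => q.elim 0 (fun p => f p + 1), ?_, fun k => ?_⟩
    · rintro (_ | p) (_ | q) hpq
      · rfl
      · simp at hpq
      · simp at hpq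
      · simpa [hf.eq_iff] using hpq
    · rcases k with _ | k
      · convert HasSchmidtRankLE.compl_singleton ψ.emit none
        ext (_ | x) <;> simp
      · have h1 := (ih k).comp (B := some '' {q : Option P | k + 1 ≤ q.elim 0 (fun p => f p + 1)})
          (fun x q => q.elim (x none) (fun p => x (some (some p)))) ?_ ?_
        -- For a positive threshold the new photon and the spin are on the same side, so the
        -- constraint that they agree is a one-sided factor.
        · convert h1.mul_right (γ := fun x => if x (some none) = x none then 1 else 0) ?_ using 1
          · ext x
            simp [QState.emit]
          · intro x y hxy
            simp only [hxy none (by simp), hxy (some none) (by simp)]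
        · rintro _ ⟨p, hp, rfl⟩ x y hxy
          exact hxy (some (some p)) (by simpa using hp)
        · rintro (_ | p) hp x y hxy
          · exact hxy none (by simp)
          · exact hxy (some (some p)) (by simpa using hp)
  | measureSpin b h ih =>
    obtain ⟨f, hf, ih⟩ := ih
    refine ⟨f, hf, fun k => ?_⟩
    convert (ih k).mul_right (γ := fun x => if x none = b then 1 else 0) ?_ using 1
    · ext x
      simp
    · intro x y hxy
      simp only [hxy none (by simp)]

/-- With `n` fusions, the Schmidt rank across the cuts of a suitable order of the photons is at
most `2 ^ (n + 1)`. -/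
theorem FusionBuilds.hasSchmidtRankLE {𝒰 : Set (Matrix (Fin 2) (Fin 2) ℂ)} {P : Type u} {n : ℕ}
    {ψ : QState P} (h : FusionBuilds 𝒰 P n ψ) :
    ∃ f : P → ℕ, f.Injective ∧ ∀ k, HasSchmidtRankLE ψ {p | k ≤ f p} (2 ^ (n + 1)) := by
  induction h with
  | source b h =>
    obtain ⟨f, hf, h⟩ := h.hasSchmidtRankLE
    refine ⟨f, hf, fun k => (h k).comp (fun x q => q.elim b x) ?_ ?_⟩
    · rintro _ ⟨p, hp, rfl⟩ x y hxy
      exact hxy p hp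
    · rintro (_ | p) hp x y hxy
      · rfl
      · exact hxy p (by simpa using hp)
  | relabel e h ih =>
    obtain ⟨f, hf, ih⟩ := ih
    refine ⟨fun q => f (e.symm q), hf.comp e.symm.injective,
      fun k => (ih k).comp (fun x p => x (e p)) ?_ ?_⟩
    · intro p hp x y hxy
      exact hxy (e p) (by simpa using hp)
    · intro p hp x y hxy
      exact hxy (e p) (by simpa using hp)
  | gate U hU p h ih =>
    obtain ⟨f, hf, ih⟩ := ih
    exact ⟨f, hf, fun k => (ih k).gate U p⟩
  | measure b h ih =>
    obtain ⟨f, hf, ih⟩ := ih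
    refine ⟨fun p => f (some p), hf.comp (Option.some_injective _),
      fun k => (ih k).comp (fun x q => q.elim b x) ?_ ?_⟩
    · rintro (_ | p) hp x y hxy
      · rfl
      · exact hxy p (by simpa using hp)
    · rintro (_ | p) hp x y hxy
      · rfl
      · exact hxy p (by simpa using hp)
  | @fuse P n ψ s t h ih =>
    obtain ⟨f, hf, ih⟩ := ih
    refine ⟨fun p => f (some (some p)),
      hf.comp ((Option.some_injective _).comp (Option.some_injective _)), fun k => ?_⟩
    -- For fixed `b` both fused photons have constant values, which cannot raise the rank; the two
    -- values of `b` account for the doubling.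
    have key (b : Fin 2) : HasSchmidtRankLE (fun x : P → Fin 2 =>
        ψ (fun q => q.elim b (fun q' => q'.elim (b + t) x)) * (-1) ^ (s * b : Fin 2).val)
        {p | k ≤ f (some (some p))} (2 ^ (n + 1)) := by
      refine ((ih k).comp (fun x q => q.elim b (fun q' => q'.elim (b + t) x)) ?_ ?_).mul_const _
      · rintro (_ | _ | p) hp x y hxy
        · rfl
        · rfl
        · exact hxy p (by simpa using hp)
      · rintro (_ | _ | p) hp x y hxy
        · rfl
        · rfl
        · exact hxy p (by simpa using hp)
    convert (key 0).add (key 1) using 1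
    · ext x
      simp only [QState.fuse, Fin.sum_univ_two, mul_comm]
    · ring

/-! ### Spectra of multiples of projections. -/

namespace Matrix.IsHermitian

variable {m : Type*} [Fintype m] [DecidableEq m] {ρ : Matrix m m ℂ} {c : ℝ}

/-- On an eigenvector the relation becomes `λ² = cλ`. -/
theorem eigenvalues_eq_zero_or_eq (hρ : ρ.IsHermitian) (h : ρ * ρ = (c : ℂ) • ρ) (i : m) :
    hρ.eigenvalues i = 0 ∨ hρ.eigenvalues i = c := by
  set v : m → ℂ := ⇑(hρ.eigenvectorBasis i) with hv
  have h1 : ρ.mulVec v = (hρ.eigenvalues i : ℂ) • v := by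
    simpa using hρ.mulVec_eigenvectorBasis i
  have hv0 : v ≠ 0 := by
    have := hρ.eigenvectorBasis.orthonormal.ne_zero i
    simpa [hv] using this
  have h2 : (ρ * ρ).mulVec v = (hρ.eigenvalues i : ℂ) • (hρ.eigenvalues i : ℂ) • v := by
    rw [← Matrix.mulVec_mulVec, h1, Matrix.mulVec_smul, h1]
  rw [h, Matrix.smul_mulVec, h1, smul_smul, smul_smul] at h2
  have h3 := smul_left_injective ℂ hv0 h2
  have h4 : c * hρ.eigenvalues i = hρ.eigenvalues i * hρ.eigenvalues i := by exact_mod_cast h3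
  by_cases h0 : hρ.eigenvalues i = 0
  · exact Or.inl h0
  · exact Or.inr (mul_right_cancel₀ h0 h4).symm

theorem sum_eigenvalues_eq_one (hρ : ρ.IsHermitian) (ht : ρ.trace = 1) :
    ∑ i, hρ.eigenvalues i = 1 := by
  have := hρ.trace_eq_sum_eigenvalues
  rw [ht] at this
  apply Complex.ofReal_injective
  simpa using this.symm

/-- The rank counts the nonzero eigenvalues; all of them equal `c` and they sum to the trace. -/
theorem rank_mul_eq_one (hρ : ρ.IsHermitian) (h : ρ * ρ = (c : ℂ) • ρ) (ht : ρ.trace = 1) :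
    ρ.rank * c = 1 := by
  rw [hρ.rank_eq_card_non_zero_eigs, ← hρ.sum_eigenvalues_eq_one ht, Fintype.card_subtype,
    ← nsmul_eq_mul, ← Finset.sum_const, Finset.sum_filter]
  refine Finset.sum_congr rfl fun i _ => ?_
  rcases hρ.eigenvalues_eq_zero_or_eq h i with hi | hi <;> simp [hi]
  exact fun h => h.symm

theorem entropy_eq (hρ : ρ.IsHermitian) (h : ρ * ρ = (c : ℂ) • ρ) (ht : ρ.trace = 1) :
    -∑ i, hρ.eigenvalues i * Real.logb 2 (hρ.eigenvalues i) = -Real.logb 2 c := by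
  have : ∀ i, hρ.eigenvalues i * Real.logb 2 (hρ.eigenvalues i) =
      hρ.eigenvalues i * Real.logb 2 c := fun i => by
    rcases hρ.eigenvalues_eq_zero_or_eq h i with hi | hi <;> simp [hi]
  simp_rw [this]
  rw [← Finset.sum_mul, hρ.sum_eigenvalues_eq_one ht, one_mul]

end Matrix.IsHermitian

/-! ### Character sums and kernels over `ZMod 2`. -/

/-- The nontrivial character of `ℤ/2`. -/
noncomputable def sgn : AddChar (ZMod 2) ℂ where
  toFun z := (-1) ^ z.val
  map_zero_eq_one' := by simp
  map_add_eq_mul' a b := by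
    have h : (-1 : ℂ) ^ (a + b).val = (-1) ^ (a.val + b.val) := by
      rw [ZMod.val_add, ← neg_one_pow_eq_pow_mod_two]
    rw [h, pow_add]

theorem sgn_apply (z : ZMod 2) : sgn z = (-1) ^ z.val := rfl

theorem sgn_mul_self (z : ZMod 2) : sgn z * sgn z = 1 := by
  rw [← AddChar.map_add_eq_mul, CharTwo.add_self_eq_zero, AddChar.map_zero_eq_one]

theorem star_sgn (z : ZMod 2) : star (sgn z) = sgn z := by
  simp [sgn_apply]

theorem sgn_ne_one {z : ZMod 2} (hz : z ≠ 0) : sgn z ≠ 1 := by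
  have h : z.val = 1 := by
    have := z.val_lt
    have := (ZMod.val_ne_zero z).2 hz
    omega
  rw [sgn_apply, h]
  norm_num

section LinearAlgebra

open scoped Matrix

theorem add_self_eq_zero_of_zmod_two {m : Type*} (a : m → ZMod 2) : a + a = 0 := by
  ext i
  exact CharTwo.add_self_eq_zero _

variable {m k : Type*} [Fintype m] [Fintype k]

/-- Orthogonality of characters: `b ↦ sgn (v ⬝ᵥ b)` is trivial only for `v = 0`, as the basis
vectors show. -/
theorem sum_sgn_dotProduct [DecidableEq k] (v : k → ZMod 2) :
    ∑ b, sgn (v ⬝ᵥ b) = if v = 0 then 2 ^ Fintype.card k else 0 := by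
  let χ : AddChar (k → ZMod 2) ℂ :=
    { toFun := fun b => sgn (v ⬝ᵥ b)
      map_zero_eq_one' := by simp
      map_add_eq_mul' := fun b c => by rw [dotProduct_add, AddChar.map_add_eq_mul] }
  have hχ : χ = 0 ↔ v = 0 := by
    constructor
    · intro h
      ext j
      by_contra hj
      refine sgn_ne_one hj ?_
      have := DFunLike.congr_fun h (Pi.single j 1)
      simpa [χ] using this
    · rintro rfl
      ext b
      simp [χ]
  classical
  have := AddChar.sum_eq_ite χ
  simp only [hχ] at this
  simpa [χ] using this

/-- The indicator function of the left kernel of `Γ`. -/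
def leftKernelIndicator (Γ : Matrix m k (ZMod 2)) (a : m → ZMod 2) : ℂ :=
  if a ᵥ* Γ = 0 then 1 else 0

/-- The sum is the size of the left kernel, found by rank-nullity for the transpose. -/
theorem sum_leftKernelIndicator [DecidableEq m] (Γ : Matrix m k (ZMod 2)) :
    (∑ a, leftKernelIndicator Γ a) * 2 ^ Γ.rank = 2 ^ Fintype.card m := by
  classical
  have h1 : ∑ a, leftKernelIndicator Γ a =
      (Nat.card (LinearMap.ker Γ.transpose.mulVecLin) : ℂ) := by
    simp only [leftKernelIndicator, Finset.sum_boole]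
    rw [← Fintype.card_subtype, ← Nat.card_eq_fintype_card]
    congr 1
    exact Nat.card_congr (Equiv.subtypeEquivRight fun a => by
      rw [LinearMap.mem_ker, Matrix.mulVecLin_apply, Matrix.mulVec_transpose])
  have h2 := LinearMap.finrank_range_add_finrank_ker Γ.transpose.mulVecLin
  have h3 : Nat.card (LinearMap.ker Γ.transpose.mulVecLin) =
      2 ^ Module.finrank (ZMod 2) (LinearMap.ker Γ.transpose.mulVecLin) := by
    rw [Module.natCard_eq_pow_finrank (K := ZMod 2)]
    simp
  rw [Module.finrank_fintype_fun_eq_card] at h2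
  rw [h1, h3, ← h2, ← Γ.rank_transpose, Matrix.rank]
  push_cast
  ring

/-- The indicator of a finite subgroup convolved with itself is the indicator times the order of the
subgroup. -/
theorem sum_leftKernelIndicator_mul [DecidableEq m] (Γ : Matrix m k (ZMod 2)) (a d : m → ZMod 2) :
    ∑ c, leftKernelIndicator Γ (a + c) * leftKernelIndicator Γ (c + d) =
      leftKernelIndicator Γ (a + d) * ∑ c, leftKernelIndicator Γ c := by
  rw [← Equiv.sum_comp (Equiv.addLeft a), Finset.mul_sum]
  refine Finset.sum_congr rfl fun c _ => ?_
  have h1 : a + (a + c) = c := by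
    rw [← add_assoc, add_self_eq_zero_of_zmod_two, zero_add]
  simp only [Equiv.coe_addLeft, h1, leftKernelIndicator]
  by_cases hc : c ᵥ* Γ = 0
  · have : (a + c + d) ᵥ* Γ = (a + d) ᵥ* Γ := by
      simp [Matrix.add_vecMul, hc]
    simp [hc, this]
  · simp [hc]

end LinearAlgebra

/-! ### Reduced density matrices of graph states. -/

section GraphState

open scoped Matrix ComplexOrder

variable {V : Type u} [Fintype V] [DecidableEq V]

/-- The part of the adjacency matrix with rows in `A` and columns outside `A`. -/
abbrev cutMatrix (G : SimpleGraph V) [DecidableRel G.Adj] (A : Finset V) :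
    Matrix {v // v ∈ A} {v // v ∉ A} (ZMod 2) :=
  (G.adjMatrix (ZMod 2)).submatrix (fun i : {v // v ∈ A} => (i : V))
    (fun j : {v // v ∉ A} => (j : V))

/-- The product of the `CZ` phases of a set of edges splits, across the cut `A`, into phases on
both sides and the phases of the edges in the cut. -/
theorem exists_prod_phases_eq (A : Finset V) (E : Finset (Sym2 V)) :
    ∃ (f : ({v // v ∈ A} → ZMod 2) → ZMod 2) (g : ({v // v ∉ A} → ZMod 2) → ZMod 2), ∀ a b,
      (∏ e ∈ E, Sym2.lift (α := V) (β := ℂ)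
        ⟨fun i j => sgn ((if h : i ∈ A then a ⟨i, h⟩ else b ⟨i, h⟩) *
          (if h : j ∈ A then a ⟨j, h⟩ else b ⟨j, h⟩)), fun i j => by
            beta_reduce; rw [mul_comm]⟩ e) =
      sgn (f a + g b + ∑ i, ∑ j, if s(i.1, j.1) ∈ E then a i * b j else 0) := by
  induction E using Finset.induction_on with
  | empty => exact ⟨0, 0, fun a b => by simp⟩
  | insert e E he ih =>
    obtain ⟨f, g, ih⟩ := ih
    -- Edges inside `A` are absorbed into `f`, edges outside into `g`; only a crossing edge adds a
    -- bilinear term.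
    have key : (∃ u v : {v // v ∈ A}, e = s(u.1, v.1)) ∨ (∃ u v : {v // v ∉ A}, e = s(u.1, v.1)) ∨
        ∃ (u : {v // v ∈ A}) (v : {v // v ∉ A}), e = s(u.1, v.1) := by
      induction e using Sym2.ind with
      | _ u v =>
        by_cases hu : u ∈ A <;> by_cases hv : v ∈ A
        · exact Or.inl ⟨⟨u, hu⟩, ⟨v, hv⟩, rfl⟩
        · exact Or.inr (Or.inr ⟨⟨u, hu⟩, ⟨v, hv⟩, rfl⟩)
        · exact Or.inr (Or.inr ⟨⟨v, hv⟩, ⟨u, hu⟩, Sym2.eq_swap⟩)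
        · exact Or.inr (Or.inl ⟨⟨u, hu⟩, ⟨v, hv⟩, rfl⟩)
    rcases key with ⟨u, v, rfl⟩ | ⟨u, v, rfl⟩ | ⟨u, v, rfl⟩
    · refine ⟨fun a => f a + a u * a v, g, fun a b => ?_⟩
      have h1 : ∀ (i : {v // v ∈ A}) (j : {v // v ∉ A}),
          s(i.1, j.1) ∈ insert s(u.1, v.1) E ↔ s(i.1, j.1) ∈ E := by
        intro i j
        rw [Finset.mem_insert, or_iff_right]
        intro h
        rcases Sym2.eq_iff.1 h with h | h
        · exact j.2 (h.2 ▸ v.2)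
        · exact j.2 (h.2 ▸ u.2)
      rw [Finset.prod_insert he, ih]
      simp only [h1, Sym2.lift_mk, u.2, v.2, dif_pos, ← AddChar.map_add_eq_mul]
      congr 1
      ring
    · refine ⟨f, fun b => g b + b u * b v, fun a b => ?_⟩
      have h1 : ∀ (i : {v // v ∈ A}) (j : {v // v ∉ A}),
          s(i.1, j.1) ∈ insert s(u.1, v.1) E ↔ s(i.1, j.1) ∈ E := by
        intro i j
        rw [Finset.mem_insert, or_iff_right]
        intro h
        rcases Sym2.eq_iff.1 h with h | h
        · exact u.2 (h.1 ▸ i.2)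
        · exact v.2 (h.1 ▸ i.2)
      rw [Finset.prod_insert he, ih]
      simp only [h1, Sym2.lift_mk, u.2, v.2, dif_neg, not_false_eq_true, ← AddChar.map_add_eq_mul]
      congr 1
      ring
    · refine ⟨f, g, fun a b => ?_⟩
      have h1 : ∀ (i : {v // v ∈ A}) (j : {v // v ∉ A}),
          (if s(i.1, j.1) ∈ insert s(u.1, v.1) E then a i * b j else 0) =
            (if s(i.1, j.1) ∈ E then a i * b j else 0) +
              if i = u then (if j = v then a i * b j else 0) else 0 := by
        intro i j
        have h2 : s(i.1, j.1) = s(u.1, v.1) ↔ i = u ∧ j = v := by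
          constructor
          · intro h
            rcases Sym2.eq_iff.1 h with h | h
            · exact ⟨Subtype.ext h.1, Subtype.ext h.2⟩
            · exact absurd (h.2 ▸ u.2) j.2
          · rintro ⟨rfl, rfl⟩
            rfl
        simp only [← ite_and, ← h2, Finset.mem_insert]
        by_cases h3 : s(i.1, j.1) = s(u.1, v.1)
        · simp [h3, he]
        · simp [h3]
      rw [Finset.prod_insert he, ih]
      simp only [h1, Finset.sum_add_distrib, Sym2.lift_mk, u.2, v.2, dif_pos, dif_neg,
        not_false_eq_true, ← AddChar.map_add_eq_mul]
      congr 1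
      simp
      ring

theorem exists_bipartiteMatrix_graphState_eq (G : SimpleGraph V) [DecidableRel G.Adj]
    (A : Finset V) :
    ∃ (f : ({v // v ∈ A} → ZMod 2) → ZMod 2) (g : ({v // v ∉ A} → ZMod 2) → ZMod 2),
      ∀ (a : {v // v ∈ A} → ZMod 2) (b : {v // v ∉ A} → ZMod 2),
      bipartiteMatrix (graphState G) A a b =
        sgn (f a + g b + (a ᵥ* cutMatrix G A) ⬝ᵥ b) *
          ((Real.sqrt 2 : ℝ) : ℂ)⁻¹ ^ Fintype.card V := by
  obtain ⟨f, g, h⟩ := exists_prod_phases_eq A G.edgeFinset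
  refine ⟨f, g, fun a b => ?_⟩
  have h1 : (a ᵥ* cutMatrix G A) ⬝ᵥ b =
      ∑ i, ∑ j, if s(i.1, j.1) ∈ G.edgeFinset then a i * b j else 0 := by
    rw [← Matrix.dotProduct_mulVec]
    simp only [dotProduct, Matrix.mulVec, Finset.mul_sum, Matrix.submatrix_apply,
      SimpleGraph.adjMatrix_apply, SimpleGraph.mem_edgeFinset, SimpleGraph.mem_edgeSet]
    refine Finset.sum_congr rfl fun i _ => Finset.sum_congr rfl fun j _ => ?_
    split_ifs <;> simp
  rw [h1, ← h a b]
  -- `ZMod 2` unfolds to `Fin 2` and `sgn` to a power of `-1`.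
  rfl

/-- In the partial trace the phases `g b` cancel, and the remaining character sum over `b` vanishes
unless `a + c` is in the left kernel. -/
theorem reducedDensity_graphState (G : SimpleGraph V) [DecidableRel G.Adj] (A : Finset V) :
    ∃ f : ({v // v ∈ A} → ZMod 2) → ZMod 2, ∀ a c : {v // v ∈ A} → ZMod 2,
      reducedDensity (graphState G) A a c =
        (1 / 2) ^ A.card * (sgn (f a) * sgn (f c) * leftKernelIndicator (cutMatrix G A) (a + c)) := by
  obtain ⟨f, g, h⟩ := exists_bipartiteMatrix_graphState_eq G A
  refine ⟨f, fun a c => ?_⟩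
  have h1 : reducedDensity (graphState G) A a c = ∑ b : {v // v ∉ A} → ZMod 2,
      bipartiteMatrix (graphState G) A a b * star (bipartiteMatrix (graphState G) A c b) := rfl
  have hs : star (((Real.sqrt 2 : ℝ) : ℂ)⁻¹ ^ Fintype.card V) =
      ((Real.sqrt 2 : ℝ) : ℂ)⁻¹ ^ Fintype.card V := by
    simp
  have hs2 : ((Real.sqrt 2 : ℝ) : ℂ)⁻¹ ^ Fintype.card V * ((Real.sqrt 2 : ℝ) : ℂ)⁻¹ ^ Fintype.card V
      = (1 / 2) ^ Fintype.card V := by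
    rw [← mul_pow, ← mul_inv, ← Complex.ofReal_mul, Real.mul_self_sqrt (by norm_num)]
    norm_num
  have hV : Fintype.card V = A.card + Fintype.card {v // v ∉ A} := by
    rw [← Fintype.card_coe A, Fintype.card_subtype_compl]
    have := Fintype.card_subtype_le (fun v => v ∈ A)
    omega
  have h2 : ∀ b : {v // v ∉ A} → ZMod 2,
      bipartiteMatrix (graphState G) A a b * star (bipartiteMatrix (graphState G) A c b) =
        (1 / 2) ^ Fintype.card V * (sgn (f a) * sgn (f c)) *
          sgn (((a + c) ᵥ* cutMatrix G A) ⬝ᵥ b) := by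
    intro b
    rw [h, h, star_mul', star_sgn, hs, Matrix.add_vecMul, add_dotProduct]
    simp only [AddChar.map_add_eq_mul]
    linear_combination (sgn (f a) * sgn (g b) * sgn ((a ᵥ* cutMatrix G A) ⬝ᵥ b) *
      (sgn (f c) * sgn (g b) * sgn ((c ᵥ* cutMatrix G A) ⬝ᵥ b))) * hs2 +
      (1 / 2) ^ Fintype.card V * sgn (f a) * sgn (f c) * sgn ((a ᵥ* cutMatrix G A) ⬝ᵥ b) *
        sgn ((c ᵥ* cutMatrix G A) ⬝ᵥ b) * sgn_mul_self (g b)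
  rw [h1, Finset.sum_congr rfl fun b _ => h2 b, ← Finset.mul_sum, sum_sgn_dotProduct,
    leftKernelIndicator, hV, pow_add]
  split_ifs
  · have : ((1 / 2 : ℂ)) ^ Fintype.card {v // v ∉ A} * 2 ^ Fintype.card {v // v ∉ A} = 1 := by
      rw [← mul_pow]
      norm_num
    linear_combination ((1 / 2) ^ A.card * (sgn (f a) * sgn (f c))) * this
  · simp

/-- Up to the signs `f`, the matrix is convolution with the indicator of the left kernel, so its
square only rescales it, by `2 ^ (-|A|)` times the size of that kernel. -/
theorem reducedDensity_graphState_mul_self (G : SimpleGraph V) [DecidableRel G.Adj]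
    (A : Finset V) :
    reducedDensity (graphState G) A * reducedDensity (graphState G) A =
      (((1 / 2) ^ cutRank G A : ℝ) : ℂ) • reducedDensity (graphState G) A := by
  obtain ⟨f, h⟩ := reducedDensity_graphState G A
  have hK := sum_leftKernelIndicator (cutMatrix G A)
  rw [Fintype.card_coe] at hK
  ext (a : {v // v ∈ A} → ZMod 2) (d : {v // v ∈ A} → ZMod 2)
  have h1 : (reducedDensity (graphState G) A * reducedDensity (graphState G) A) a d =
      ∑ c : {v // v ∈ A} → ZMod 2,
        reducedDensity (graphState G) A a c * reducedDensity (graphState G) A c d := rfl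
  have h2 : ∀ c : {v // v ∈ A} → ZMod 2,
      reducedDensity (graphState G) A a c * reducedDensity (graphState G) A c d =
        (1 / 2) ^ A.card * ((1 / 2) ^ A.card * (sgn (f a) * sgn (f d))) *
          (leftKernelIndicator (cutMatrix G A) (a + c) *
            leftKernelIndicator (cutMatrix G A) (c + d)) := by
    intro c
    rw [h, h]
    linear_combination ((1 / 2) ^ A.card * ((1 / 2) ^ A.card * (sgn (f a) * sgn (f d))) *
          (leftKernelIndicator (cutMatrix G A) (a + c) *
            leftKernelIndicator (cutMatrix G A) (c + d))) * sgn_mul_self (f c)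
  rw [h1, Finset.sum_congr rfl fun c _ => h2 c, ← Finset.mul_sum, sum_leftKernelIndicator_mul]
  have h3 : (1 / 2 : ℂ) ^ A.card * ∑ c, leftKernelIndicator (cutMatrix G A) c =
      (((1 / 2) ^ cutRank G A : ℝ) : ℂ) := by
    have h4 : (2 : ℂ) ^ cutRank G A ≠ 0 := by positivity
    have h5 : (2 : ℂ) ^ A.card ≠ 0 := by positivity
    push_cast
    rw [one_div, inv_pow, inv_pow, ← mul_right_inj' h5, ← mul_left_inj' h4]
    rw [← mul_assoc, mul_inv_cancel₀ h5, one_mul, mul_assoc, inv_mul_cancel₀ h4, mul_one]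
    exact hK
  have h6 : ((((1 / 2) ^ cutRank G A : ℝ) : ℂ) • reducedDensity (graphState G) A) a d =
      (((1 / 2) ^ cutRank G A : ℝ) : ℂ) * reducedDensity (graphState G) A a d := rfl
  rw [h6, h, ← h3]
  ring

theorem trace_reducedDensity_graphState (G : SimpleGraph V) [DecidableRel G.Adj] (A : Finset V) :
    (reducedDensity (graphState G) A).trace = 1 := by
  obtain ⟨f, h⟩ := reducedDensity_graphState G A
  have h1 : (reducedDensity (graphState G) A).trace =
      ∑ a : {v // v ∈ A} → ZMod 2, reducedDensity (graphState G) A a a := rfl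
  have h2 : ∀ a : {v // v ∈ A} → ZMod 2,
      reducedDensity (graphState G) A a a = (1 / 2) ^ A.card := by
    intro a
    rw [h, sgn_mul_self, add_self_eq_zero_of_zmod_two]
    simp [leftKernelIndicator]
  rw [h1, Finset.sum_congr rfl fun a _ => h2 a]
  simp

/-- The entanglement entropy of a graph state is the cut-rank. -/
theorem entanglementEntropy_graphState (G : SimpleGraph V) [DecidableRel G.Adj] (A : Finset V) :
    entanglementEntropy (graphState G) A = cutRank G A := by
  rw [entanglementEntropy, Matrix.IsHermitian.entropy_eq _
    (reducedDensity_graphState_mul_self G A) (trace_reducedDensity_graphState G A),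
    Real.logb_pow, one_div, Real.logb_inv, Real.logb_self_eq_one (by norm_num)]
  ring

/-- The Schmidt rank of a graph state is `2` to the power of the cut-rank. -/
theorem rank_bipartiteMatrix_graphState (G : SimpleGraph V) [DecidableRel G.Adj] (A : Finset V) :
    (bipartiteMatrix (graphState G) A).rank = 2 ^ cutRank G A := by
  have h := Matrix.IsHermitian.rank_mul_eq_one (reducedDensity_isHermitian (graphState G) A)
    (reducedDensity_graphState_mul_self G A) (trace_reducedDensity_graphState G A)
  rw [reducedDensity, Matrix.rank_self_mul_conjTranspose] at h
  have h4 : (2 : ℝ) ^ cutRank G A ≠ 0 := by positivity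
  rw [one_div, inv_pow, ← div_eq_mul_inv, div_eq_one_iff_eq h4] at h
  exact_mod_cast h

end GraphState

/-! ### Products of GHZ states from one emitter. -/

/-- The Hadamard gate. -/
noncomputable def hadamard : Matrix (Fin 2) (Fin 2) ℂ :=
  ((Real.sqrt 2 : ℝ) : ℂ)⁻¹ • !![1, 1; 1, -1]

theorem inv_sqrt_two_mul_self :
    ((Real.sqrt 2 : ℝ) : ℂ)⁻¹ * ((Real.sqrt 2 : ℝ) : ℂ)⁻¹ = 1 / 2 := by
  rw [← mul_inv, ← Complex.ofReal_mul, Real.mul_self_sqrt (by norm_num)]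
  norm_num

theorem inv_sqrt_two_ne_zero : ((Real.sqrt 2 : ℝ) : ℂ)⁻¹ ≠ 0 := by
  simp

theorem star_hadamard : star hadamard = hadamard := by
  ext i j
  fin_cases i <;> fin_cases j <;> simp [hadamard, Matrix.star_apply]

theorem hadamard_conj (A : Matrix (Fin 2) (Fin 2) ℂ) :
    hadamard * A * hadamard =
      (1 / 2 : ℂ) • (!![1, 1; 1, -1] * A * !![1, 1; 1, -1] : Matrix (Fin 2) (Fin 2) ℂ) := by
  simp only [hadamard, Matrix.smul_mul, Matrix.mul_smul, smul_smul, inv_sqrt_two_mul_self]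

/-- Conjugation exchanges `X` and `Z` and negates `Y`. No other gate is used in the construction. -/
theorem hadamard_mem_cliffordGates : hadamard ∈ cliffordGates := by
  constructor
  · rw [Matrix.mem_unitaryGroup_iff, star_hadamard]
    have := hadamard_conj 1
    rw [mul_one, mul_one] at this
    rw [this]
    ext i j
    fin_cases i <;> fin_cases j <;> simp <;> norm_num
  · rw [star_hadamard]
    rintro A (rfl | rfl | rfl)
    · left; right; right
      rw [hadamard_conj, Set.mem_singleton_iff]
      ext i j
      fin_cases i <;> fin_cases j <;> simp <;> norm_num
    · right; right; left
      rw [hadamard_conj]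
      ext i j
      fin_cases i <;> fin_cases j <;> simp <;> ring
    · left; left
      rw [hadamard_conj]
      ext i j
      fin_cases i <;> fin_cases j <;> simp <;> norm_num

theorem hadamard_apply (a b : Fin 2) :
    hadamard a b = ((Real.sqrt 2 : ℝ) : ℂ)⁻¹ * (-1) ^ (a * b : Fin 2).val := by
  fin_cases a <;> fin_cases b <;> simp [hadamard]

/-- The bit string `x` is constant on the fibres of `c`. -/
def FibreConstant {Q W : Type*} (c : Q → W) (x : Q → Fin 2) : Prop :=
  ∀ p q, c p = c q → x p = x q

theorem fibreConstant_option {P W : Type*} {c : Option P → W} {x : Option P → Fin 2} :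
    FibreConstant c x ↔ (∀ q, c none = c (some q) → x none = x (some q)) ∧
      FibreConstant (fun p => c (some p)) (fun p => x (some p)) := by
  constructor
  · exact fun h => ⟨fun q => h none (some q), fun p q => h (some p) (some q)⟩
  · rintro ⟨h1, h2⟩ (_ | p) (_ | q) hpq
    · rfl
    · exact h1 q hpq
    · exact (h1 p hpq.symm).symm
    · exact h2 p q hpq

open Classical in
/-- The (unnormalised) product of GHZ states of the fibres of `c`. -/
noncomputable def ghzState {Q W : Type*} (c : Q → W) : QState Q :=
  fun x => if FibreConstant c x then 1 else 0

open scoped Classical in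
theorem ghzState_comp_equiv {P Q W : Type*} (c : Q → W) (e : P ≃ Q) :
    (ghzState (fun p => c (e p))).relabel e = ghzState c := by
  ext x
  have : FibreConstant (fun p => c (e p)) (fun p => x (e p)) ↔ FibreConstant c x :=
    ⟨fun h p q => by simpa using h (e.symm p) (e.symm q), fun h p q => h (e p) (e q)⟩
  simp only [ghzState, QState.relabel, this]

open scoped Classical in
theorem emit_ghzState {P W : Type*} (c : P → W) (m : W) (a : ℂ) :
    (a • ghzState (fun q : Option P => q.elim m c)).emit =
      a • ghzState (fun q : Option (Option P) => q.elim m (fun q' => q'.elim m c)) := by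
  ext x
  by_cases hx : x (some none) = x none
  · have : FibreConstant (fun q : Option P => q.elim m c)
        (fun q => q.elim (x none) (fun p => x (some (some p)))) ↔
        FibreConstant (fun q : Option (Option P) => q.elim m (fun q' => q'.elim m c)) x := by
      simp only [fibreConstant_option, Option.forall, Option.elim_none, Option.elim_some, hx]
      tauto
    simp only [QState.emit, hx, ghzState, Pi.smul_apply, this, if_true]
  · have : ¬ FibreConstant (fun q : Option (Option P) => q.elim m (fun q' => q'.elim m c)) x :=
      fun h => hx (h (some none) none rfl)
    simp [QState.emit, hx, ghzState, this]

open scoped Classical in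
/-- Measuring the spin in the `X` basis disentangles it from the photons. -/
theorem measure_gate_ghzState {P W : Type*} [DecidableEq (Option P)] (c : P → W) (p : P) (m : W)
    (hm : ∀ q, c q ≠ m) (a : ℂ) :
    QState.gate hadamard none
      (fun x : Option P → Fin 2 => if x none = 0 then
        (a • ghzState (fun q : Option P => q.elim (c p) c)).gate hadamard none x else 0) =
      (a / 2) • ghzState (fun q : Option P => q.elim m c) := by
  ext x
  have hmm : ∀ q, m ≠ c q := fun q => (hm q).symm
  have hg : ghzState (fun q : Option P => q.elim m c) x = ghzState c (fun p => x (some p)) := by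
    simp [ghzState, fibreConstant_option, hmm]
  have h1 (b : Fin 2) : ghzState (fun q : Option P => q.elim (c p) c) (Function.update x none b) =
      if x (some p) = b then ghzState c (fun p => x (some p)) else 0 := by
    simp only [ghzState, fibreConstant_option, Option.elim_none, Option.elim_some,
      Function.update_self, ne_eq, reduceCtorEq, not_false_eq_true, Function.update_of_ne]
    by_cases hb : x (some p) = b
    · subst hb
      have : (∀ q, c p = c q → x (some p) = x (some q)) ∧ FibreConstant c (fun p => x (some p)) ↔
          FibreConstant c (fun p => x (some p)) :=
        ⟨fun h => h.2, fun h => ⟨h p, h⟩⟩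
      simp only [this, if_true]
    · rw [if_neg hb, if_neg]
      exact fun h => hb (h.1 p rfl).symm
  simp only [QState.gate, Fin.sum_univ_two, hadamard_apply, Pi.smul_apply, Function.update_self,
    Function.update_idem, if_true, one_ne_zero, if_false, mul_zero, add_zero, h1, hg, smul_eq_mul]
  have h2 := inv_sqrt_two_mul_self
  generalize ((Real.sqrt 2 : ℝ) : ℂ)⁻¹ = s at *
  generalize ghzState c (fun p => x (some p)) = g
  -- Row 0 of the Hadamard matrix is constant, so outcome 0 introduces no phase depending on the bit
  -- shared with the spin.
  have h3 : x (some p) = 0 ∨ x (some p) = 1 := by omega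
  rcases h3 with h | h <;> rw [h] <;> simp <;> linear_combination (a * g) * h2

/-- A single emitter generates any product of GHZ states, together with its spin. -/
theorem exists_emitterGenerates_ghzState {𝒰 : Set (Matrix (Fin 2) (Fin 2) ℂ)}
    (hH : hadamard ∈ 𝒰) (N : ℕ) : ∀ (Q : Type u) [Finite Q], Nat.card Q = N →
    ∀ (c : Q → ℕ) (m : ℕ), (∀ q, c q ≤ m) → ∃ (P : Type u) (e : P ≃ Q) (a : ℂ), a ≠ 0 ∧
      EmitterGenerates 𝒰 P (a • ghzState (fun q : Option P => q.elim m (fun p => c (e p)))) := by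
  classical
  induction N with
  | zero =>
    intro Q _ hQ c m hm
    have : IsEmpty Q := (Nat.card_eq_zero.1 hQ).resolve_right (not_infinite_iff_finite.2 ‹_›)
    refine ⟨PEmpty, Equiv.equivOfIsEmpty _ _, _, inv_sqrt_two_ne_zero, ?_⟩
    convert EmitterGenerates.init (𝒰 := 𝒰) using 1
    ext x
    simp [ghzState, FibreConstant, Option.forall]
  | succ N ih =>
    intro Q _ hQ c m hm
    have : Nonempty Q := (Nat.card_pos_iff.1 (by omega)).1
    -- A qubit of maximal label is emitted last, with the spin in its block. Then either `m` is this
    -- label, or `m` exceeds all labels and an `X` measurement of the spin opens a new block.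
    obtain ⟨q₀, hq₀⟩ := Finite.exists_max c
    obtain ⟨P, e, a, ha, h⟩ := ih {q // q ≠ q₀} (by
      have := Nat.card_congr (Equiv.optionSubtypeNe q₀)
      rw [Finite.card_option] at this
      omega) (fun q => c q) (c q₀) (fun q => hq₀ q)
    let e' : Option P ≃ Q := (Equiv.optionCongr e).trans (Equiv.optionSubtypeNe q₀)
    have hc : (fun q : Option P => c (e' q)) = fun q => q.elim (c q₀) (fun p => c (e p)) := by
      ext (_ | p) <;> simp [e']
    have h1 := h.emit
    rw [emit_ghzState] at h1
    by_cases hmq : m = c q₀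
    · subst hmq
      refine ⟨Option P, e', a, ha, ?_⟩
      rw [hc]
      exact h1
    · refine ⟨Option P, e', a / 2, by simpa using ha, ?_⟩
      have h2 := ((h1.gate hadamard hH none).measureSpin 0).gate hadamard hH none
      rw [← hc] at h2
      rw [← measure_gate_ghzState (fun q => c (e' q)) none m]
      · exact h2
      · intro q
        have := hq₀ (e' q)
        have := hm q₀
        omega

open scoped Classical in
/-- A product of GHZ states is built without fusions. -/
theorem exists_fusionBuilds_ghzState {𝒰 : Set (Matrix (Fin 2) (Fin 2) ℂ)} (hH : hadamard ∈ 𝒰)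
    {Q : Type u} [Finite Q] (c : Q → ℕ) :
    ∃ a : ℂ, a ≠ 0 ∧ FusionBuilds 𝒰 Q 0 (a • ghzState c) := by
  obtain ⟨m, hm⟩ := (Set.finite_range c).bddAbove
  have hm : ∀ q, c q ≤ m := fun q => hm ⟨q, rfl⟩
  -- The label `m + 1` is unused by photons, so the spin is unentangled and can be measured out.
  obtain ⟨P, e, a, ha, h⟩ := exists_emitterGenerates_ghzState hH _ Q rfl c (m + 1)
    (fun q => (hm q).trans (Nat.le_succ m))
  refine ⟨a, ha, ?_⟩
  convert (FusionBuilds.source 0 h).relabel e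
  rw [← ghzState_comp_equiv c e]
  have h1 : ∀ q, ¬ m + 1 = c q := fun q => by have := hm q; omega
  ext x
  simp [QState.relabel, QState.measure, ghzState, fibreConstant_option, h1]

/-! ### `CZ` gates by fusion of copies. -/

/-- The qubits agree with the qubits `i v`, `v : V`, of which they are copies. -/
def IsCopied {Q V : Type*} (c : Q → V) (i : V → Q) (x : Q → Fin 2) : Prop :=
  ∀ q, x q = x (i (c q))

open Classical in
/-- The amplitude `φ` of the qubits `V`, each of which is copied to the qubits in its fibre
under `c`; the original qubits are given by the section `i` of `c`. -/
noncomputable def copyState {Q V : Type*} (c : Q → V) (i : V → Q) (φ : QState V) : QState Q :=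
  fun x => if IsCopied c i x then φ (fun v => x (i v)) else 0

-- The fusion sets both photons to a common bit `b`; the copy of `v` forces `b = x v`, and the
-- Hadamard entry between `b` and the bit `x u` of the other copy is the `CZ` phase over `√2`.
open scoped Classical in
theorem fuse_gate_copyState {Q V : Type*} [DecidableEq (Option (Option Q))] (c : Q → V) (i : V → Q)
    (φ : QState V) (u v : V) :
    ((copyState (fun q : Option (Option Q) => q.elim u (fun q' => q'.elim v c))
      (fun w => some (some (i w))) φ).gate hadamard none).fuse 0 0 =
      copyState c i
        (fun x => φ x * (((Real.sqrt 2 : ℝ) : ℂ)⁻¹ * (-1) ^ (x u * x v : Fin 2).val)) := by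
  ext x
  have h1 (b d : Fin 2) : copyState (fun q : Option (Option Q) => q.elim u (fun q' => q'.elim v c))
      (fun w => some (some (i w))) φ (Function.update
        (fun q => q.elim b (fun q' => q'.elim (b + 0) x)) none d) =
      if d = x (i u) ∧ b = x (i v) then copyState c i φ x else 0 := by
    have : IsCopied (fun q : Option (Option Q) => q.elim u (fun q' => q'.elim v c))
        (fun w => some (some (i w))) (Function.update
        (fun q => q.elim b (fun q' => q'.elim (b + 0) x)) none d) ↔
        (d = x (i u) ∧ b = x (i v)) ∧ IsCopied c i x := by
      simp only [IsCopied, Option.forall, Option.elim_none, Option.elim_some, Function.update_self,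
        ne_eq, reduceCtorEq, not_false_eq_true, Function.update_of_ne, add_zero, and_assoc]
    simp only [copyState, this, ite_and]
    simp
  simp only [QState.fuse, QState.gate, h1, hadamard_apply, Option.elim_none]
  simp only [copyState]
  split_ifs with hx
  · have hu : x (i u) = 0 ∨ x (i u) = 1 := by omega
    have hv : x (i v) = 0 ∨ x (i v) = 1 := by omega
    rcases hu with hu | hu <;> rcases hv with hv | hv <;>
      simp [Fin.sum_univ_two, hu, hv, mul_comm]
  · simp

/-- Fusing copies of the qubits multiplies the amplitude by the phases of `CZ` gates. -/
theorem exists_fusionBuilds_of_copyState {𝒰 : Set (Matrix (Fin 2) (Fin 2) ℂ)}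
    (hH : hadamard ∈ 𝒰) {V : Type u} [Finite V] (l : List (V × V)) :
    ∃ (Q : Type u) (_ : Finite Q) (c : Q → V) (i : V → Q), (∀ v, c (i v) = v) ∧
      ∀ (φ : QState V) (n : ℕ), FusionBuilds 𝒰 Q n (copyState c i φ) →
        FusionBuilds 𝒰 V (n + l.length) (fun x => φ x * (l.map fun e =>
          ((Real.sqrt 2 : ℝ) : ℂ)⁻¹ * (-1) ^ (x e.1 * x e.2 : Fin 2).val).prod) := by
  classical
  induction l with
  | nil =>
    refine ⟨V, ‹_›, id, id, fun _ => rfl, fun φ n h => ?_⟩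
    have : (fun x => φ x * (([] : List (V × V)).map fun e =>
        ((Real.sqrt 2 : ℝ) : ℂ)⁻¹ * (-1) ^ (x e.1 * x e.2 : Fin 2).val).prod) =
        copyState id id φ := by
      ext x
      simp [copyState, IsCopied]
    rw [this]
    exact h
  | cons e l ih =>
    obtain ⟨Q, _, c, i, hci, ih⟩ := ih
    -- Each edge needs one additional copy of each endpoint. As `φ` is arbitrary in `ih`, it can
    -- carry the phases already applied.
    refine ⟨Option (Option Q), inferInstance, fun q => q.elim e.1 (fun q' => q'.elim e.2 c),
      fun w => some (some (i w)), hci, fun φ n h => ?_⟩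
    have h1 := (h.gate hadamard hH none).fuse 0 0
    rw [fuse_gate_copyState c i] at h1
    convert ih _ _ h1 using 1
    · rw [List.length_cons]
      omega
    · ext x
      simp [mul_assoc]

open scoped Classical in
/-- Every graph state can be constructed, with one fusion for each edge. -/
theorem fusionConstructible_card_edgeFinset {V : Type u} [Fintype V] [DecidableEq V]
    (G : SimpleGraph V) [DecidableRel G.Adj] {𝒰 : Set (Matrix (Fin 2) (Fin 2) ℂ)}
    (hH : hadamard ∈ 𝒰) : FusionConstructible 𝒰 G G.edgeFinset.card := by
  obtain ⟨Q, _, c, i, hci, h⟩ := exists_fusionBuilds_of_copyState hH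
    (G.edgeFinset.toList.map fun e => Quot.out e)
  obtain ⟨a, ha, hQ⟩ := exists_fusionBuilds_ghzState hH (fun q => (Fintype.equivFin V (c q) : ℕ))
  -- GHZ blocks indexed by the vertices are copies of a constant amplitude, that is, of `|+⟩` on
  -- every vertex.
  have hcopy : a • ghzState (fun q => (Fintype.equivFin V (c q) : ℕ)) =
      copyState c i (fun _ => a) := by
    ext x
    have : FibreConstant (fun q => (Fintype.equivFin V (c q) : ℕ)) x ↔ IsCopied c i x := by
      constructor
      · exact fun hx q => hx _ _ (by simp only [hci])
      · intro hx p q hpq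
        rw [hx p, hx q, (Fintype.equivFin V).injective (Fin.val_injective hpq)]
    simp [ghzState, copyState, this]
  rw [hcopy] at hQ
  have h2 := h _ _ hQ
  rw [List.length_map, Finset.length_toList, zero_add] at h2
  -- One factor `1/√2` comes from each fusion, and one per vertex is divided out for the
  -- normalisation of `graphState`.
  refine ⟨a * ((Real.sqrt 2 : ℝ) : ℂ)⁻¹ ^ G.edgeFinset.card /
    ((Real.sqrt 2 : ℝ) : ℂ)⁻¹ ^ Fintype.card V, ?_, ?_⟩
  · have := inv_sqrt_two_ne_zero
    positivity
  · convert h2 using 1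
    ext x
    have h3 := inv_sqrt_two_ne_zero
    rw [List.map_map, Finset.prod_map_toList]
    simp only [Function.comp_def, Finset.prod_mul_distrib, Finset.prod_const]
    have h4 : ∏ e ∈ G.edgeFinset, (-1 : ℂ) ^ (x (Quot.out e).1 * x (Quot.out e).2 : Fin 2).val =
        ∏ e ∈ G.edgeFinset, Sym2.lift (α := V) (β := ℂ)
          ⟨fun i j => (-1) ^ (x i * x j).val, fun i j => by
            beta_reduce; rw [mul_comm (x i)]⟩ e := by
      refine Finset.prod_congr rfl fun e _ => ?_
      conv_rhs => rw [← Quot.out_eq e]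
      rfl
    rw [h4, Pi.smul_apply, graphState, smul_eq_mul]
    field_simp

/-! ### Vertex orders and the final comparison. -/

/-- An injective function to `ℕ` orders the vertices; the initial segments are its sublevel
sets. -/
theorem exists_prefixSet_iff_lt {V : Type*} [Fintype V] {f : V → ℕ} (hf : f.Injective) :
    ∃ p : Fin (Fintype.card V) ≃ V, ∀ k, ∃ t, ∀ v, v ∈ prefixSet p k ↔ f v < t := by
  let : LinearOrder V := LinearOrder.lift' f hf
  let p : Fin (Fintype.card V) ≃o V := monoEquivOfFin V rfl
  refine ⟨p.toEquiv, fun k => ?_⟩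
  by_cases hk : k < Fintype.card V
  · refine ⟨f (p ⟨k, hk⟩), fun v => ?_⟩
    have h1 : p.symm v < ⟨k, hk⟩ ↔ v < p ⟨k, hk⟩ := p.symm_apply_lt
    have h2 : v < p ⟨k, hk⟩ ↔ f v < f (p ⟨k, hk⟩) := Iff.rfl
    rw [← h2, ← h1]
    simp only [prefixSet, Finset.mem_filter, Finset.mem_univ, true_and]
    rfl
  · refine ⟨Finset.univ.sup f + 1, fun v => iff_of_true ?_ ?_⟩
    · have := (p.symm v).2
      simp only [prefixSet, Finset.mem_filter, Finset.mem_univ, true_and]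
      exact this.trans_le (not_lt.1 hk)
    · exact Nat.lt_succ_of_le (Finset.le_sup (Finset.mem_univ v))

section Graph

variable {V : Type u} [Fintype V] [DecidableEq V]

/-- The coefficient matrix factors through `Fin r`; bits on the far side are set to 0, which the
factors cannot see. -/
theorem HasSchmidtRankLE.rank_bipartiteMatrix_le {ψ : QState V} {A : Finset V} {r : ℕ}
    (h : HasSchmidtRankLE ψ A r) : (bipartiteMatrix ψ A).rank ≤ r := by
  obtain ⟨α, β, hα, hβ, h⟩ := h
  let L : Matrix ({v // v ∈ A} → Fin 2) (Fin r) ℂ :=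
    fun a i => α i (fun v => if h : v ∈ A then a ⟨v, h⟩ else 0)
  let R : Matrix (Fin r) ({v // v ∉ A} → Fin 2) ℂ :=
    fun i b => β i (fun v => if h : v ∈ A then 0 else b ⟨v, h⟩)
  have hLR : bipartiteMatrix ψ A = L * R := by
    ext a b
    rw [bipartiteMatrix, h, Matrix.mul_apply]
    refine Finset.sum_congr rfl fun i _ => congrArg₂ _ (hα i fun v hv => ?_) (hβ i fun v hv => ?_)
    · have hv : v ∈ A := hv
      simp [hv]
    · have hv : v ∉ A := hv
      simp [hv]
  rw [hLR]
  exact (Matrix.rank_mul_le_left L R).trans (by simpa using L.rank_le_card_width)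

theorem linearRankWidth_le_of_fusionConstructible {𝒰 : Set (Matrix (Fin 2) (Fin 2) ℂ)}
    {G : SimpleGraph V} [DecidableRel G.Adj] {n : ℕ} (h : FusionConstructible 𝒰 G n) :
    linearRankWidth G ≤ n + 1 := by
  obtain ⟨c, hc, h⟩ := h
  obtain ⟨f, hf, h⟩ := h.hasSchmidtRankLE
  obtain ⟨p, hp⟩ := exists_prefixSet_iff_lt hf
  refine (ciInf_le' _ p).trans (ciSup_le fun k => ?_)
  obtain ⟨t, ht⟩ := hp k
  -- Prefixes are sublevel sets while the rank bound is for superlevel sets, hence the complement.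
  have hA : {v | t ≤ f v}ᶜ = (prefixSet p k : Set V) := by
    ext v
    simp [ht]
  have h1 := (h t).compl.mul_const c⁻¹
  rw [hA] at h1
  have h2 : (fun x => (c • graphState G) x * c⁻¹) = graphState G := by
    ext x
    rw [Pi.smul_apply, smul_eq_mul, mul_right_comm, mul_inv_cancel₀ hc, one_mul]
  rw [h2] at h1
  have h3 := h1.rank_bipartiteMatrix_le
  rw [rank_bipartiteMatrix_graphState] at h3
  exact (Nat.pow_le_pow_iff_right (by norm_num)).1 h3

/-- Entropy and cut-rank agree on every prefix, and the cast to `ℝ` commutes with these infima and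
suprema. -/
theorem minStaticQubits_eq_linearRankWidth (G : SimpleGraph V) [DecidableRel G.Adj] :
    minStaticQubits G = (linearRankWidth G : ℝ) := by
  have hcast : Continuous (Nat.cast : ℕ → ℝ) := continuous_of_discreteTopology
  have : Nonempty (Fin (Fintype.card V) ≃ V) := ⟨(Fintype.equivFin V).symm⟩
  rw [linearRankWidth, Nat.mono_cast.map_ciInf_of_continuousAt hcast.continuousAt
    (OrderBot.bddBelow _)]
  refine iInf_congr fun p => ?_
  rw [Nat.mono_cast.map_ciSup_of_continuousAt hcast.continuousAt (Set.finite_range _).bddAbove]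
  exact iSup_congr fun k => entanglementEntropy_graphState G _

end Graph

theorem mainTheorem5 {V : Type*} [Fintype V] [DecidableEq V] (G : SimpleGraph V)
    [DecidableRel G.Adj] (𝒰 : Set (Matrix (Fin 2) (Fin 2) ℂ))
    (hCl : cliffordGates ⊆ 𝒰) (hUn : ∀ U ∈ 𝒰, U ∈ Matrix.unitaryGroup (Fin 2) ℂ) :
    (∃ n : ℕ, FusionConstructible 𝒰 G n) ∧
      minStaticQubits G = (linearRankWidth G : ℝ) ∧
      (minFusions 𝒰 G : ℝ) + 1 ≥ minStaticQubits G := by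
  have hex : ∃ n : ℕ, FusionConstructible 𝒰 G n :=
    ⟨_, fusionConstructible_card_edgeFinset G (hCl hadamard_mem_cliffordGates)⟩
  refine ⟨hex, minStaticQubits_eq_linearRankWidth G, ?_⟩
  rw [minStaticQubits_eq_linearRankWidth]
  -- Existence makes the infimum an attained minimum; `sInf ∅ = 0` would carry no information.
  exact_mod_cast linearRankWidth_le_of_fusionConstructible (Nat.sInf_mem hex)
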